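/- \textbf{Ergodic Lemma.} Let $(X,d)$ be a nonempty compact metric space, let $m\ge 1$ and $n\ge 1$ be integers, and give $X^m$ the maximum metric. Let $\mathcal S=(X,(\phi_j)_{0\le j<n},(p_j)_{0\le j<n})$ consist of continuous maps $\phi_j:X^m\to X$ and continuous weights $p_j:X^m\to[0,1]$ with $\sum_{j}p_j(x)=1$ for every $x\in X^m$. Assume: (E1) for each $j$ there are $a_{j,0},\dots,a_{j,m-1}>0$ with $\sum_i a_{j,i}<1$ and $d(\phi_j(x),\phi_j(y))\le\sum_{i}a_{j,i}\,d(x_i,y_i)$ for all $x,y\in X^m$; (E2) there is $\delta>0$ with $p_j(x)\ge\delta$ for all $j$ and $x$, and for each $j$ there are $c_{j,0},\dots,c_{j,m-1}>0$ with $\sum_i c_{j,i}<1$ and $|p_j(x)-p_j(y)|\le\sum_i c_{j,i}\,d(x_i,y_i)$ for all $x,y\in X^m$. Let $\hat\phi_j(x_0,\dots,x_{m-1})=(x_1,\dots,x_{m-1},\phi_j(x_0,\dots,x_{m-1}))$, and let $\mathcal L$ be the Markov operator on Borel probability measures on $X^m$ given by $\int g\,d\mathcal L(\alpha)=\int\sum_j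 p_j(x)\,g(\hat\phi_j(x))\,d\alpha(x)$ for all $g\in C(X^m,\mathbb R)$. For $x=(x_0,\dots,x_{m-1})\in X^m$ and $w\in\Omega=\{0,\dots,n-1\}^{\mathbb N}$, the orbit is defined by $x_j(w)=x_j$ for $0\le j<m$ and $x_{j+m}(w)=\phi_{w_j}(x_j(w),\dots,x_{j+m-1}(w))$ for $j\ge0$. Let $P_x$ be the Borel probability measure on $\Omega$ whose value on the cylinder of sequences beginning with $w_0\cdots w_{k-1}$ is $\prod_{i=0}^{k-1}p_{w_i}(x_i(w),\dots,x_{i+m-1}(w))$. Then $\mathcal L$ has exactly one fixed point $\alpha$ (the extended Hutchinson measure), and for each $x\in X^m$ there is a measurable set $\Omega_x\subseteq\Omega$ with $P_x(\Omega_x)=1$ such that for every $w\in\Omega_x$ and every $g\in C(X^m,\mathbb R)$ $$\frac1N\sum_{k=0}^{N-1}g\big(x_{mk}(w),x_{mk+1}(w),\dots,x_{mk+m-1}(w)\big)\longrightarrow\int_{X^m}g\,d\alpha\qquad(N\to\infty).$$ -/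

import Mathlib

open MeasureTheory ProbabilityTheory Filter Topology

/-- A generalized iterated function system with place dependent probabilities, of degree `m` with
`n` maps: continuous maps `φ j : X^m → X` and continuous weights `p j : X^m → [0,1]` with sum `1`.
The space `X^m` is `Fin m → X`, with the maximum metric. -/
structure GIFSpdp (X : Type*) [TopologicalSpace X] (m n : ℕ) where
  φ : Fin n → (Fin m → X) → X
  p : Fin n → (Fin m → X) → ℝ
  continuous_φ : ∀ j, Continuous (φ j)
  continuous_p : ∀ j, Continuous (p j)
  p_mem : ∀ j x, p j x ∈ Set.Icc (0 : ℝ) 1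
  sum_p : ∀ x, ∑ j, p j x = 1

/-- The class `Lip_{a_0, …, a_{m-1}}(X^m, Y)`. -/
def LipCoeff {X Y : Type*} [PseudoMetricSpace X] [PseudoMetricSpace Y] {m : ℕ}
    (a : Fin m → ℝ) (f : (Fin m → X) → Y) : Prop :=
  (∀ i, 0 < a i) ∧ ∀ x y, dist (f x) (f y) ≤ ∑ i, a i * dist (x i) (y i)

namespace GIFSpdp

section Metric

variable {X : Type*} [MetricSpace X] {m n : ℕ}

/-- Hypothesis E1: each map is in some `Lip_{a}` with total coefficient `< 1`. -/
def E1 (S : GIFSpdp X m n) : Prop :=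
  ∀ j, ∃ a : Fin m → ℝ, LipCoeff a (S.φ j) ∧ ∑ i, a i < 1

/-- Hypothesis E2: the weights are bounded below by a positive constant, and each of them is in
some `Lip_{c}` with total coefficient `< 1`. -/
def E2 (S : GIFSpdp X m n) : Prop :=
  (∃ δ : ℝ, 0 < δ ∧ ∀ j x, δ ≤ S.p j x) ∧
    ∀ j, ∃ c : Fin m → ℝ, LipCoeff c (S.p j) ∧ ∑ i, c i < 1

end Metric

section Dynamics

variable {X : Type*} [TopologicalSpace X] {m n : ℕ}

/-- The maps of the extension: `(x_0, …, x_{m-1}) ↦ (x_1, …, x_{m-1}, φ_j(x_0, …, x_{m-1}))`. -/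
def ext (S : GIFSpdp X m n) (j : Fin n) (x : Fin m → X) : Fin m → X :=
  fun k => if h : (k : ℕ) + 1 < m then x ⟨k + 1, h⟩ else S.φ j x

theorem continuous_ext (S : GIFSpdp X m n) (j : Fin n) : Continuous (S.ext j) := by
  refine continuous_pi fun k => ?_
  unfold ext
  split_ifs with h
  · exact continuous_apply _
  · exact S.continuous_φ j

/-- The orbit `x_0, x_1, …` of the system: the first `m` terms are the given starting points and
`x_{j+m} = φ_{w_j}(x_j, …, x_{j+m-1})`. -/
def orbit (S : GIFSpdp X m n) (x : Fin m → X) (w : ℕ → Fin n) (j : ℕ) : X :=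
  if h : j < m then x ⟨j, h⟩
  else S.φ (w (j - m)) (fun i : Fin m => orbit S x w (j - m + i))
termination_by j
decreasing_by omega

/-- The block `(x_k, …, x_{k+m-1})` of the orbit. -/
def block (S : GIFSpdp X m n) (x : Fin m → X) (w : ℕ → Fin n) (k : ℕ) : Fin m → X :=
  fun i => S.orbit x w (k + i)

theorem block_zero (S : GIFSpdp X m n) (x : Fin m → X) (w : ℕ → Fin n) : S.block x w 0 = x := by
  funext i
  simp [block, orbit]

/-- The blocks of the orbit form the orbit of the extension. -/
theorem block_succ (S : GIFSpdp X m n) (x : Fin m → X) (w : ℕ → Fin n) (k : ℕ) :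
    S.block x w (k + 1) = S.ext (w k) (S.block x w k) := by
  funext i
  unfold block ext
  split_ifs with h
  · congr 1
    simp only
    omega
  · have e : k + 1 + (i : ℕ) = k + m := by omega
    rw [e, orbit]
    simp

theorem block_congr (S : GIFSpdp X m n) (x : Fin m → X) {w w' : ℕ → Fin n} {k : ℕ}
    (h : ∀ i < k, w i = w' i) : S.block x w k = S.block x w' k := by
  induction k with
  | zero => simp [block_zero]
  | succ k ih =>
    rw [block_succ, block_succ, ih fun i hi => h i (by omega), h k (by omega)]

/-- The law on the symbols that gives `j` the probability `p_j(x)`. -/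
noncomputable def symbolLaw (S : GIFSpdp X m n) (x : Fin m → X) : Measure (Fin n) :=
  ∑ j, ENNReal.ofReal (S.p j x) • Measure.dirac j

theorem symbolLaw_singleton (S : GIFSpdp X m n) (x : Fin m → X) (j : Fin n) :
    S.symbolLaw x {j} = ENNReal.ofReal (S.p j x) := by
  simp [symbolLaw, Measure.finsetSum_apply, Set.indicator_apply]

instance (S : GIFSpdp X m n) (x : Fin m → X) : IsProbabilityMeasure (S.symbolLaw x) := by
  constructor
  simp only [symbolLaw, Measure.finsetSum_apply, Measure.smul_apply, measure_univ, smul_eq_mul,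
    mul_one]
  rw [← ENNReal.ofReal_sum_of_nonneg fun j _ => (S.p_mem j x).1, S.sum_p, ENNReal.ofReal_one]

/-- A finite word `w_0 … w_k` prolonged to an infinite one (the added letters are irrelevant). -/
def prolong {k : ℕ} (w : Finset.Iic k → Fin n) (i : ℕ) : Fin n :=
  if h : i ≤ k then w ⟨i, Finset.mem_Iic.2 h⟩ else w ⟨0, Finset.mem_Iic.2 (Nat.zero_le k)⟩

/-- The law of the symbol `w_{k+1}` given `w_0, …, w_k`: the symbol `j` has probability
`p_j(x_{k+1}, …, x_{k+m})`, where the point on the right is determined by `w_0, …, w_k`. -/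
noncomputable def step (S : GIFSpdp X m n) (x : Fin m → X) (k : ℕ) :
    Kernel (Finset.Iic k → Fin n) (Fin n) :=
  Kernel.ofFunOfCountable fun w => S.symbolLaw (S.block x (prolong w) (k + 1))

instance (S : GIFSpdp X m n) (x : Fin m → X) (k : ℕ) : IsMarkovKernel (S.step x k) :=
  ⟨fun w => inferInstanceAs
    (IsProbabilityMeasure (S.symbolLaw (S.block x (prolong w) (k + 1))))⟩

/-- The path measure `P_x` on `Ω = {0, …, n-1}^ℕ`, built from its successive conditional laws;
`pathMeasure_cylinder` gives its values on cylinders. -/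
noncomputable def pathMeasure (S : GIFSpdp X m n) (x : Fin m → X) : Measure (ℕ → Fin n) :=
  Kernel.trajMeasure (X := fun _ => Fin n) (S.symbolLaw x) (S.step x)

instance (S : GIFSpdp X m n) (x : Fin m → X) : IsProbabilityMeasure (S.pathMeasure x) := by
  unfold pathMeasure
  infer_instance

/-- The cylinder of the words that agree with `w` at the places `0, …, k-1`. -/
def cylinder (w : ℕ → Fin n) (k : ℕ) : Set (ℕ → Fin n) := {v | ∀ i < k, v i = w i}

theorem pathMeasure_cylinder (S : GIFSpdp X m n) (x : Fin m → X) (w : ℕ → Fin n) (k : ℕ) :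
    S.pathMeasure x (cylinder w k) =
      ∏ i ∈ Finset.range k, ENNReal.ofReal (S.p (w i) (S.block x w i)) := by
  have hcyl : ∀ a, cylinder w (a + 1) = Preorder.frestrictLe (π := fun _ => Fin n) a ⁻¹'
      {Preorder.frestrictLe (π := fun _ => Fin n) a w} := by
    intro a
    ext v
    simp [cylinder, funext_iff]
  have hmeas : ∀ a, Measurable (Preorder.frestrictLe (π := fun _ : ℕ => Fin n) a) :=
    fun a => Preorder.measurable_frestrictLe a
  induction k with
  | zero => simp [cylinder]
  | succ k ih =>
    rw [Finset.prod_range_succ, ← ih]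
    cases k with
    | zero =>
      have h0 : cylinder w 0 = Set.univ := by simp [cylinder]
      rw [h0, measure_univ, one_mul, block_zero, hcyl, ← Measure.map_apply (hmeas 0) (by measurability)]
      unfold pathMeasure Kernel.trajMeasure
      rw [Measure.map_comp _ _ (hmeas 0), Kernel.traj_map_frestrictLe, Kernel.partialTraj_self,
        Measure.id_comp, Measure.map_apply (by fun_prop) (by measurability), ← symbolLaw_singleton]
      congr 1
      ext v
      simp [funext_iff]
    | succ a =>
      have key := Kernel.map_frestrictLe_trajMeasure_compProd_eq_map_trajMeasure
        (X := fun _ => Fin n) (μ₀ := S.symbolLaw x) (κ := S.step x) (a := a)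
      have e : cylinder w (a + 1 + 1) = (fun v : ℕ → Fin n =>
          (Preorder.frestrictLe (π := fun _ => Fin n) a v, v (a + 1))) ⁻¹'
          ({Preorder.frestrictLe (π := fun _ => Fin n) a w} ×ˢ {w (a + 1)}) := by
        ext v
        simp only [cylinder, Set.mem_ofPred_eq, Set.mem_preimage, Set.mem_prod,
          Set.mem_singleton_iff, funext_iff]
        constructor
        · intro h
          exact ⟨fun i => h i (by have := Finset.mem_Iic.1 i.2; omega), h _ (by omega)⟩
        · rintro ⟨h1, h2⟩ i hi
          rcases Nat.lt_succ_iff_lt_or_eq.1 hi with h | rfl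
          · exact h1 ⟨i, Finset.mem_Iic.2 (by omega)⟩
          · exact h2
      rw [e, ← Measure.map_apply ((hmeas a).prodMk (measurable_pi_apply _)) (by measurability)]
      unfold pathMeasure
      rw [← key, Measure.compProd_apply_prod (by measurability) (by measurability),
        lintegral_singleton, mul_comm, Measure.map_apply (hmeas a) (by measurability), ← hcyl]
      congr 1
      change S.symbolLaw _ _ = _
      rw [symbolLaw_singleton]
      congr 2
      apply block_congr
      intro i hi
      simp [prolong, Nat.lt_succ_iff.1 hi]

end Dynamics

section Markov

variable {X : Type*} [MetricSpace X] [CompactSpace X] {m n : ℕ}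

/-- The transfer operator of the extension, `B g (x) = ∑ j, p_j(x) g(ext_j(x))`. -/
def transfer (S : GIFSpdp X m n) (g : C(Fin m → X, ℝ)) : C(Fin m → X, ℝ) where
  toFun x := ∑ j, S.p j x * g (S.ext j x)
  continuous_toFun := continuous_finsetSum _ fun j _ =>
    (S.continuous_p j).mul (g.continuous.comp (S.continuous_ext j))

variable [MeasurableSpace X] [BorelSpace X]

/-- The Markov operator of the extension on measures; by `integral_markov` it is the dual of
`transfer`. -/
noncomputable def markovMeasure (S : GIFSpdp X m n) (α : Measure (Fin m → X)) :
    Measure (Fin m → X) :=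
  ∑ j, (α.withDensity fun x => ENNReal.ofReal (S.p j x)).map (S.ext j)

theorem isProbabilityMeasure_markovMeasure (S : GIFSpdp X m n) (α : Measure (Fin m → X))
    [IsProbabilityMeasure α] : IsProbabilityMeasure (S.markovMeasure α) := by
  constructor
  simp only [markovMeasure, Measure.finsetSum_apply]
  simp_rw [Measure.map_apply (S.continuous_ext _).measurable MeasurableSet.univ, Set.preimage_univ,
    withDensity_apply _ MeasurableSet.univ, Measure.restrict_univ]
  rw [← lintegral_finsetSum]
  · simp_rw [← ENNReal.ofReal_sum_of_nonneg fun j _ => (S.p_mem j _).1, S.sum_p]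
    simp
  · exact fun j _ => (S.continuous_p j).measurable.ennreal_ofReal

/-- The Markov operator of the extension on `Prob(X^m)`. -/
noncomputable def markov (S : GIFSpdp X m n) (α : ProbabilityMeasure (Fin m → X)) :
    ProbabilityMeasure (Fin m → X) :=
  ⟨S.markovMeasure (α : Measure (Fin m → X)),
    S.isProbabilityMeasure_markovMeasure (α : Measure (Fin m → X))⟩

theorem integral_markov (S : GIFSpdp X m n) (α : ProbabilityMeasure (Fin m → X))
    (g : C(Fin m → X, ℝ)) :
    ∫ x, g x ∂(S.markov α : Measure (Fin m → X)) = ∫ x, S.transfer g x ∂(α : Measure (Fin m → X)) := by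
  have hα : ∀ h : C(Fin m → X, ℝ), Integrable h (α : Measure (Fin m → X)) := fun h =>
    h.continuous.integrable_of_hasCompactSupport (HasCompactSupport.of_compactSpace h)
  have hP := S.isProbabilityMeasure_markovMeasure (α : Measure (Fin m → X))
  have hg : Integrable g (S.markovMeasure (α : Measure (Fin m → X))) :=
    g.continuous.integrable_of_hasCompactSupport (HasCompactSupport.of_compactSpace g)
  change ∫ x, g x ∂(S.markovMeasure (α : Measure (Fin m → X))) = _
  unfold markovMeasure at hg ⊢
  rw [integral_finsetSum_measure (integrable_finsetSum_measure.1 hg)]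
  have e : ∀ j, ∫ x, g x ∂(((α : Measure (Fin m → X)).withDensity
      fun x => ENNReal.ofReal (S.p j x)).map (S.ext j)) =
      ∫ x, S.p j x * g (S.ext j x) ∂(α : Measure (Fin m → X)) := by
    intro j
    rw [integral_map (S.continuous_ext j).measurable.aemeasurable
      g.continuous.aestronglyMeasurable,
      integral_withDensity_eq_integral_toReal_smul
        (S.continuous_p j).measurable.ennreal_ofReal (by simp)]
    simp [ENNReal.toReal_ofReal (S.p_mem j _).1]
  simp_rw [e]
  rw [← integral_finsetSum]
  · rfl
  · exact fun j _ => hα ⟨fun x => S.p j x * g (S.ext j x),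
      (S.continuous_p j).mul (g.continuous.comp (S.continuous_ext j))⟩

/-- `α` is the extended Hutchinson measure of `S`: the unique fixed point of the Markov operator
of the extension in `Prob(X^m)`. -/
def IsExtendedHutchinson (S : GIFSpdp X m n) (α : ProbabilityMeasure (Fin m → X)) : Prop :=
  S.markov α = α ∧ ∀ β : ProbabilityMeasure (Fin m → X), S.markov β = β → β = α

end Markov

end GIFSpdp

/-!
Let `T` be the transfer operator and `Z_k` the `k`-th block of the orbit. Under `P_x` the blocks
form a Markov chain, so the differences `g(Z_{l(k+1)}) - T^l g(Z_{lk})` are bounded and orthogonal,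
and their averages tend to `0` almost surely. Telescoping, the averages of `g - T^{lr} g` along
`Z_{lk}` tend to `0` for every `r`; it remains to show that `T^N g` converges uniformly to the
constant `∫ g dα`, and to handle all `g` at once by a countable dense family.

For the convergence, weight the `i`-th coordinate distance by `θ^i` with `θ > 1` close to `1`: all
maps of the extension then contract by `θ⁻¹`. Hence, up to an arbitrarily small error, the iterates
`T^N g` share a Lipschitz constant. Two points that both follow a map `j₀` of weight at least `δ`
for `M` steps end up close together, which gives
`osc(T^{N+M} g) ≤ δ^M ε + (1 - δ^M) osc(T^N g)`, and so `osc(T^N g) → 0`. Any limit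
point of the iterates of the Markov operator is then stationary, and two stationary measures give
the same limit of `T^N g`.
-/

theorem integral_sq_sum_le_of_orthogonal {Ω : Type*} [MeasurableSpace Ω] {μ : Measure Ω}
    [IsProbabilityMeasure μ] {Y : ℕ → Ω → ℝ} {C : ℝ} (hY : ∀ k, AEStronglyMeasurable (Y k) μ)
    (hC : ∀ k ω, |Y k ω| ≤ C) (horth : ∀ i j, i < j → ∫ ω, Y i ω * Y j ω ∂μ = 0) (N : ℕ) :
    ∫ ω, (∑ k ∈ Finset.range N, Y k ω) ^ 2 ∂μ ≤ N * C ^ 2 := by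
  have hYY i j : Integrable (fun ω => Y i ω * Y j ω) μ :=
    (Integrable.of_bound (hY j) C (ae_of_all _ (hC j))).bdd_mul (hY i) (ae_of_all _ (hC i))
  have hoff i j (hij : j ≠ i) : ∫ ω, Y i ω * Y j ω ∂μ = 0 := by
    rcases hij.lt_or_gt with h | h
    · simpa only [mul_comm] using horth j i h
    · exact horth i j h
  have hdiag i : ∫ ω, Y i ω * Y i ω ∂μ ≤ C ^ 2 := by
    calc ∫ ω, Y i ω * Y i ω ∂μ ≤ ∫ _, C ^ 2 ∂μ :=
          integral_mono (hYY i i) (integrable_const _) fun ω => by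
            simpa only [← sq, sq_abs] using pow_le_pow_left₀ (abs_nonneg _) (hC i ω) 2
      _ = C ^ 2 := by simp
  calc ∫ ω, (∑ k ∈ Finset.range N, Y k ω) ^ 2 ∂μ
      = ∑ i ∈ Finset.range N, ∑ j ∈ Finset.range N, ∫ ω, Y i ω * Y j ω ∂μ := by
        simp_rw [sq, Finset.sum_mul_sum]
        rw [integral_finsetSum _ fun i _ => integrable_finsetSum _ fun j _ => hYY i j]
        exact Finset.sum_congr rfl fun i _ => integral_finsetSum _ fun j _ => hYY i j
    _ = ∑ i ∈ Finset.range N, ∫ ω, Y i ω * Y i ω ∂μ :=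
        Finset.sum_congr rfl fun i hi =>
          Finset.sum_eq_single_of_mem i hi fun j _ hji => hoff i j hji
    _ ≤ ∑ _i ∈ Finset.range N, C ^ 2 := Finset.sum_le_sum fun i _ => hdiag i
    _ = N * C ^ 2 := by simp

theorem ae_tendsto_zero_of_summable_integral {Ω : Type*} [MeasurableSpace Ω] {μ : Measure Ω}
    {F : ℕ → Ω → ℝ} (hF : ∀ k, Integrable (F k) μ) (hF0 : ∀ k ω, 0 ≤ F k ω)
    (hsum : Summable fun k => ∫ ω, F k ω ∂μ) :
    ∀ᵐ ω ∂μ, Tendsto (fun k => F k ω) atTop (𝓝 0) := by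
  have hmeas k : AEMeasurable (fun ω => ENNReal.ofReal (F k ω)) μ :=
    (hF k).aestronglyMeasurable.aemeasurable.ennreal_ofReal
  have hfin : ∫⁻ ω, ∑' k, ENNReal.ofReal (F k ω) ∂μ ≠ ⊤ := by
    rw [lintegral_tsum hmeas]
    simp_rw [← ofReal_integral_eq_lintegral_ofReal (hF _) (ae_of_all _ (hF0 _))]
    exact hsum.tsum_ofReal_ne_top
  filter_upwards [ae_lt_top' (AEMeasurable.tsum hmeas) hfin] with ω hω
  have hlim := (ENNReal.tendsto_toReal ENNReal.zero_ne_top).comp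
    (ENNReal.tendsto_atTop_zero_of_tsum_ne_top hω.ne)
  simpa only [Function.comp_def, ENNReal.toReal_ofReal (hF0 _ ω), ENNReal.toReal_zero] using hlim

theorem sum_range_add_const_div {y : ℕ → ℝ} {N : ℕ} (hN : N ≠ 0) (c : ℝ) :
    (∑ k ∈ Finset.range N, (y k + c)) / N = (∑ k ∈ Finset.range N, y k) / N + c := by
  rw [Finset.sum_add_distrib, add_div, Finset.sum_const, Finset.card_range, nsmul_eq_mul,
    mul_div_cancel_left₀ c (Nat.cast_ne_zero.2 hN)]

theorem tendsto_average_add_const {y : ℕ → ℝ} {a : ℝ}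
    (h : Tendsto (fun N : ℕ => (∑ k ∈ Finset.range N, y k) / N) atTop (𝓝 a)) (c : ℝ) :
    Tendsto (fun N : ℕ => (∑ k ∈ Finset.range N, (y k + c)) / N) atTop (𝓝 (a + c)) := by
  refine (h.add_const c).congr' ?_
  filter_upwards [eventually_ne_atTop 0] with N hN
  exact (sum_range_add_const_div hN c).symm

theorem eventually_succ_sq_le_mul_sq {a : ℝ} (ha : 1 < a) :
    ∀ᶠ N : ℕ in atTop, (((N + 1) ^ 2 : ℕ) : ℝ) ≤ a * ((N ^ 2 : ℕ) : ℝ) := by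
  have hlim : Tendsto (fun N : ℕ => (1 + 1 / (N : ℝ)) ^ 2) atTop (𝓝 ((1 + 0) ^ 2)) :=
    (tendsto_one_div_atTop_nhds_zero_nat.const_add 1).pow 2
  filter_upwards [hlim.eventually_le_const (by simpa using ha), eventually_ne_atTop 0]
    with N hN hN0
  have hN0 : (N : ℝ) ≠ 0 := Nat.cast_ne_zero.2 hN0
  calc (((N + 1) ^ 2 : ℕ) : ℝ) = (1 + 1 / (N : ℝ)) ^ 2 * (N : ℝ) ^ 2 := by
        push_cast
        field_simp
    _ ≤ a * (N : ℝ) ^ 2 := mul_le_mul_of_nonneg_right hN (by positivity)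
    _ = a * ((N ^ 2 : ℕ) : ℝ) := by push_cast; rfl

theorem tendsto_average_of_tendsto_average_sq {y : ℕ → ℝ} {C a : ℝ} (hC : ∀ k, |y k| ≤ C)
    (h : Tendsto (fun N : ℕ => (∑ k ∈ Finset.range (N ^ 2), y k) / ((N ^ 2 : ℕ) : ℝ))
      atTop (𝓝 a)) :
    Tendsto (fun N : ℕ => (∑ k ∈ Finset.range N, y k) / N) atTop (𝓝 a) := by
  -- Adding `C` makes the partial sums monotone, so the squares are dense enough.
  have hmono : Monotone fun N : ℕ => ∑ k ∈ Finset.range N, (y k + C) :=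
    monotone_nat_of_le_succ fun N => by
      rw [Finset.sum_range_succ]
      linarith [neg_le_of_abs_le (hC N)]
  have hsq : Tendsto
      (fun N : ℕ => (∑ k ∈ Finset.range (N ^ 2), (y k + C)) / ((N ^ 2 : ℕ) : ℝ))
      atTop (𝓝 (a + C)) := by
    refine (h.add_const C).congr' ?_
    filter_upwards [eventually_ne_atTop 0] with N hN
    exact (sum_range_add_const_div (pow_ne_zero 2 hN) C).symm
  have hshifted := tendsto_div_of_monotone_of_exists_subseq_tendsto_div _ (a + C) hmono
    fun b hb => ⟨fun N => N ^ 2, eventually_succ_sq_le_mul_sq hb,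
      tendsto_pow_atTop two_ne_zero, hsq⟩
  simpa only [add_neg_cancel_right] using tendsto_average_add_const hshifted (-C)

/-- Rajchman's strong law of large numbers. -/
theorem ae_tendsto_average_of_orthogonal {Ω : Type*} [MeasurableSpace Ω] {μ : Measure Ω}
    [IsProbabilityMeasure μ] {Y : ℕ → Ω → ℝ} {C : ℝ} (hY : ∀ k, AEStronglyMeasurable (Y k) μ)
    (hC : ∀ k ω, |Y k ω| ≤ C) (horth : ∀ i j, i < j → ∫ ω, Y i ω * Y j ω ∂μ = 0) :
    ∀ᵐ ω ∂μ, Tendsto (fun N : ℕ => (∑ k ∈ Finset.range N, Y k ω) / N) atTop (𝓝 0) := by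
  let A (N : ℕ) (ω : Ω) : ℝ := (∑ k ∈ Finset.range N, Y k ω) / N
  have hint N : Integrable (fun ω => A N ω ^ 2) μ := by
    simp_rw [A, div_pow]
    refine (MemLp.integrable_sq ?_).div_const _
    exact memLp_finsetSum _ fun k _ => MemLp.of_bound (hY k) C (ae_of_all _ (hC k))
  have hmoment N : ∫ ω, A (N ^ 2) ω ^ 2 ∂μ ≤ 1 / (N : ℝ) ^ 2 * C ^ 2 := by
    rcases eq_or_ne N 0 with rfl | hN
    · simp [A]
    simp_rw [A, div_pow, integral_div]
    rw [div_le_iff₀ (by positivity)]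
    refine (integral_sq_sum_le_of_orthogonal hY hC horth (N ^ 2)).trans_eq ?_
    push_cast
    field_simp
  have hsum : Summable fun N : ℕ => ∫ ω, A (N ^ 2) ω ^ 2 ∂μ :=
    Summable.of_nonneg_of_le (fun N => integral_nonneg fun ω => sq_nonneg _) hmoment
      ((Real.summable_one_div_nat_pow.2 one_lt_two).mul_right (C ^ 2))
  filter_upwards [ae_tendsto_zero_of_summable_integral (fun N => hint (N ^ 2))
    (fun N ω => sq_nonneg _) hsum] with ω hω
  refine tendsto_average_of_tendsto_average_sq (fun k => hC k ω) ?_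
  have hsqrt := hω.sqrt
  simp only [Real.sqrt_sq_eq_abs, Real.sqrt_zero] at hsqrt
  exact (tendsto_zero_iff_abs_tendsto_zero _).2 hsqrt

theorem tendsto_average_sub_succ {b : ℕ → ℝ} {C : ℝ} (hC : ∀ k, |b k| ≤ C) :
    Tendsto (fun N : ℕ => (∑ k ∈ Finset.range N, (b k - b (k + 1))) / N) atTop (𝓝 0) := by
  simp_rw [Finset.sum_range_sub']
  refine squeeze_zero_norm (fun N => ?_) (tendsto_const_div_atTop_nhds_zero_nat (C + C))
  rw [norm_div, Real.norm_natCast, Real.norm_eq_abs]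
  gcongr
  exact (abs_sub _ _).trans (add_le_add (hC _) (hC _))

section Averages

variable {Y : Type*} [TopologicalSpace Y] [CompactSpace Y]

theorem lipschitzWith_average (z : ℕ → Y) (N : ℕ) :
    LipschitzWith 1 fun g : C(Y, ℝ) => (∑ k ∈ Finset.range N, g (z k)) / N := by
  refine LipschitzWith.of_dist_le_mul fun g h => ?_
  rw [NNReal.coe_one, one_mul, Real.dist_eq, ← sub_div, ← Finset.sum_sub_distrib, abs_div,
    Nat.abs_cast]
  refine div_le_of_le_mul₀ N.cast_nonneg dist_nonneg ?_
  calc |∑ k ∈ Finset.range N, (g (z k) - h (z k))|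
      ≤ ∑ k ∈ Finset.range N, |g (z k) - h (z k)| := Finset.abs_sum_le_sum_abs _ _
    _ ≤ ∑ _k ∈ Finset.range N, dist g h :=
        Finset.sum_le_sum fun k _ => (g.dist_apply_le_dist (g := h) (z k) :)
    _ = dist g h * N := by simp [mul_comm]

theorem isClosed_setOf_tendsto_average (z : ℕ → Y) {L : C(Y, ℝ) → ℝ} (hL : Continuous L) :
    IsClosed {g : C(Y, ℝ) |
      Tendsto (fun N : ℕ => (∑ k ∈ Finset.range N, g (z k)) / N) atTop (𝓝 (L g))} :=
  (LipschitzWith.uniformEquicontinuous _ 1 (lipschitzWith_average z)).equicontinuous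
    |>.isClosed_setOfPred_tendsto hL

theorem continuous_integral_continuousMap [MeasurableSpace Y] [BorelSpace Y] (μ : Measure Y)
    [IsFiniteMeasure μ] : Continuous fun g : C(Y, ℝ) => ∫ y, g y ∂μ := by
  have hcont := continuous_integral.comp (ContinuousMap.toLp (E := ℝ) 1 μ ℝ).continuous
  exact hcont.congr fun g => integral_congr_ae (ContinuousMap.coeFn_toLp μ g)

end Averages

theorem measurable_of_dependsOn_finite {ι A B : Type*} [Finite A] [MeasurableSpace A]
    [DiscreteMeasurableSpace A] [Nonempty B] [MeasurableSpace B] {s : Set ι} (hs : s.Finite)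
    {G : (ι → A) → B} (hG : DependsOn G s) : Measurable G := by
  have := hs.to_subtype
  obtain ⟨g, rfl⟩ := dependsOn_iff_exists_comp.1 hG
  exact Measurable.of_discrete.comp (Set.measurable_restrict s)

theorem integrable_of_dependsOn_finite {ι A E : Type*} [Finite A] [MeasurableSpace A]
    [DiscreteMeasurableSpace A] [NormedAddCommGroup E] {s : Set ι} (hs : s.Finite)
    {G : (ι → A) → E} (hG : DependsOn G s) (μ : Measure (ι → A)) [IsFiniteMeasure μ] :
    Integrable G μ := by
  have := hs.to_subtype
  obtain ⟨g, rfl⟩ := dependsOn_iff_exists_comp.1 hG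
  exact Integrable.of_finite.comp_measurable (Set.measurable_restrict s)

namespace GIFSpdp

section Words

variable {n : ℕ}

/-- The finite word `v` followed by the constant letter `j₀`: a representative of the cylinder of
`v`. -/
def padWord (j₀ : Fin n) {k : ℕ} (v : Fin k → Fin n) (i : ℕ) : Fin n :=
  if h : i < k then v ⟨i, h⟩ else j₀

theorem padWord_apply (j₀ : Fin n) {k : ℕ} (v : Fin k → Fin n) (i : Fin k) :
    padWord j₀ v i = v i := by
  simp [padWord]

theorem padWord_snoc (j₀ : Fin n) {k : ℕ} (v : Fin k → Fin n) (j : Fin n) :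
    padWord j₀ (Fin.snoc v j : Fin (k + 1) → Fin n) = Function.update (padWord j₀ v) k j := by
  funext i
  rcases lt_trichotomy i k with hi | rfl | hi
  · simp [padWord, Fin.snoc, hi, hi.ne, hi.trans k.lt_succ_self]
  · simp [padWord, Fin.snoc]
  · have hi' : ¬ i < k + 1 := by omega
    simp [padWord, hi', hi.ne', hi.not_gt]

theorem preimage_restrict_singleton (j₀ : Fin n) {k : ℕ} (v : Fin k → Fin n) :
    (fun (w : ℕ → Fin n) (i : Fin k) => w i) ⁻¹' {v} = cylinder (padWord j₀ v) k := by
  ext w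
  simp only [Set.mem_preimage, Set.mem_singleton_iff, funext_iff, cylinder, Set.mem_ofPred_eq,
    Fin.forall_iff]
  exact forall₂_congr fun i hi => by rw [← padWord_apply j₀ v ⟨i, hi⟩]

theorem integral_eq_sum_cylinder (μ : Measure (ℕ → Fin n)) [IsFiniteMeasure μ] {E : Type*}
    [NormedAddCommGroup E] [NormedSpace ℝ E] [CompleteSpace E] {k : ℕ}
    {G : (ℕ → Fin n) → E} (hG : DependsOn G (Set.Iio k)) (j₀ : Fin n) :
    ∫ w, G w ∂μ =
      ∑ v : Fin k → Fin n, μ.real (cylinder (padWord j₀ v) k) • G (padWord j₀ v) := by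
  have hπ : Measurable fun (w : ℕ → Fin n) (i : Fin k) => w i := by fun_prop
  have hG' (w : ℕ → Fin n) : G w = G (padWord j₀ fun i : Fin k => w i) :=
    hG fun i hi => (padWord_apply j₀ (fun i : Fin k => w i) ⟨i, hi⟩).symm
  calc ∫ w, G w ∂μ = ∫ w, G (padWord j₀ fun i : Fin k => w i) ∂μ := integral_congr_ae
        (ae_of_all _ hG')
    _ = ∫ v, G (padWord j₀ v) ∂μ.map fun w (i : Fin k) => w i :=
        (integral_map (f := fun v : Fin k → Fin n => G (padWord j₀ v)) hπ.aemeasurable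
          AEStronglyMeasurable.of_discrete).symm
    _ = ∑ v : Fin k → Fin n, μ.real (cylinder (padWord j₀ v) k) • G (padWord j₀ v) := by
        rw [integral_fintype Integrable.of_finite]
        simp_rw [map_measureReal_apply hπ (MeasurableSet.singleton _),
          preimage_restrict_singleton j₀]

end Words

section MarkovProperty

variable {X : Type*} [TopologicalSpace X] {m n : ℕ} (S : GIFSpdp X m n) (x : Fin m → X)

theorem dependsOn_comp_block {B : Type*} (f : (Fin m → X) → B) (k : ℕ) :
    DependsOn (fun w => f (S.block x w k)) (Set.Iio k) :=
  fun _ _ hw => congrArg f (S.block_congr x hw)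

theorem measureReal_cylinder (w : ℕ → Fin n) (k : ℕ) :
    (S.pathMeasure x).real (cylinder w k) =
      ∏ i ∈ Finset.range k, S.p (w i) (S.block x w i) := by
  rw [measureReal_def, pathMeasure_cylinder, ENNReal.toReal_prod]
  exact Finset.prod_congr rfl fun i _ => ENNReal.toReal_ofReal (S.p_mem _ _).1

theorem block_update {i k : ℕ} (hik : i ≤ k) (w : ℕ → Fin n) (j : Fin n) :
    S.block x (Function.update w k j) i = S.block x w i :=
  S.block_congr x fun _ hl => Function.update_of_ne (hl.trans_le hik).ne j w

theorem block_succ_update (w : ℕ → Fin n) (k : ℕ) (j : Fin n) :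
    S.block x (Function.update w k j) (k + 1) = S.ext j (S.block x w k) := by
  rw [block_succ, Function.update_self, S.block_update x le_rfl]

theorem measureReal_cylinder_succ_update (w : ℕ → Fin n) (k : ℕ) (j : Fin n) :
    (S.pathMeasure x).real (cylinder (Function.update w k j) (k + 1)) =
      (S.pathMeasure x).real (cylinder w k) * S.p j (S.block x w k) := by
  simp_rw [measureReal_cylinder, Finset.prod_range_succ, Function.update_self,
    S.block_update x le_rfl]
  congr 1
  refine Finset.prod_congr rfl fun i hi => ?_
  have hik := Finset.mem_range.1 hi
  rw [Function.update_of_ne hik.ne, S.block_update x hik.le]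

theorem integral_pathMeasure_eq_integral_sum_update {E : Type*} [NormedAddCommGroup E]
    [NormedSpace ℝ E] [CompleteSpace E] {k : ℕ} {G : (ℕ → Fin n) → E}
    (hG : DependsOn G (Set.Iio (k + 1))) :
    ∫ w, G w ∂S.pathMeasure x =
      ∫ w, ∑ j, S.p j (S.block x w k) • G (Function.update w k j) ∂S.pathMeasure x := by
  obtain ⟨w₀⟩ := nonempty_of_isProbabilityMeasure (S.pathMeasure x)
  have hsum : DependsOn (fun w => ∑ j, S.p j (S.block x w k) • G (Function.update w k j))
      (Set.Iio k) := by
    intro w w' hw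
    refine Finset.sum_congr rfl fun j _ => ?_
    rw [S.block_congr x hw]
    refine congrArg _ (hG fun i hi => ?_)
    rcases (Nat.lt_succ_iff.1 hi).lt_or_eq with hik | rfl
    · simpa only [Function.update_of_ne hik.ne] using hw i hik
    · simp only [Function.update_self]
  rw [integral_eq_sum_cylinder _ hG (w₀ 0), integral_eq_sum_cylinder _ hsum (w₀ 0),
    ← (Fin.snocEquiv fun _ : Fin (k + 1) => Fin n).sum_comp, Fintype.sum_prod_type_right]
  refine Finset.sum_congr rfl fun v _ => ?_
  simp_rw [Fin.snocEquiv, Equiv.coe_fn_mk, padWord_snoc, measureReal_cylinder_succ_update,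
    Finset.smul_sum, mul_smul]

theorem integral_mul_block_succ {k : ℕ} {F : (ℕ → Fin n) → ℝ} (hF : DependsOn F (Set.Iio k))
    (h : (Fin m → X) → ℝ) :
    ∫ w, F w * h (S.block x w (k + 1)) ∂S.pathMeasure x =
      ∫ w, F w * ∑ j, S.p j (S.block x w k) * h (S.ext j (S.block x w k))
        ∂S.pathMeasure x := by
  have hFh : DependsOn (fun w => F w * h (S.block x w (k + 1))) (Set.Iio (k + 1)) :=
    fun w w' hw => congrArg₂ (· * ·) (hF fun i hi => hw i (Nat.lt_succ_of_lt hi))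
      (S.dependsOn_comp_block x h (k + 1) hw)
  have hF_update (w : ℕ → Fin n) (j : Fin n) : F (Function.update w k j) = F w :=
    hF fun i hi => Function.update_of_ne (Set.mem_Iio.1 hi).ne j w
  rw [S.integral_pathMeasure_eq_integral_sum_update x hFh]
  simp_rw [smul_eq_mul, hF_update, S.block_succ_update x, Finset.mul_sum, mul_left_comm]

end MarkovProperty

section Chain

variable {X : Type*} [MetricSpace X] {m n : ℕ} (S : GIFSpdp X m n)

theorem integral_mul_block_add (x : Fin m → X) {k : ℕ} {F : (ℕ → Fin n) → ℝ}
    (hF : DependsOn F (Set.Iio k)) (l : ℕ) (h : C(Fin m → X, ℝ)) :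
    ∫ w, F w * h (S.block x w (k + l)) ∂S.pathMeasure x =
      ∫ w, F w * (S.transfer^[l] h) (S.block x w k) ∂S.pathMeasure x := by
  induction l generalizing h with
  | zero => rfl
  | succ l ih =>
    rw [Function.iterate_succ_apply, ← ih, ← add_assoc,
      S.integral_mul_block_succ x (hF.mono (Set.Iio_subset_Iio (Nat.le_add_right k l)))]
    rfl

theorem integral_mul_block_sub_iterate_transfer (x : Fin m → X) {k : ℕ} {F : (ℕ → Fin n) → ℝ}
    (hF : DependsOn F (Set.Iio k)) (l : ℕ) (h : C(Fin m → X, ℝ)) :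
    ∫ w, F w * (h (S.block x w (k + l)) - (S.transfer^[l] h) (S.block x w k))
      ∂S.pathMeasure x = 0 := by
  have hint (f : C(Fin m → X, ℝ)) {k' : ℕ} (hk : k ≤ k') :
      Integrable (fun w => F w * f (S.block x w k')) (S.pathMeasure x) :=
    integrable_of_dependsOn_finite (Set.finite_Iio k') (fun w w' hw => congrArg₂ (· * ·)
      (hF.mono (Set.Iio_subset_Iio hk) hw) (S.dependsOn_comp_block x f k' hw)) _
  simp_rw [mul_sub]
  rw [integral_sub (hint h (Nat.le_add_right k l)) (hint _ le_rfl),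
    S.integral_mul_block_add x hF, sub_self]

variable [CompactSpace X] (x : Fin m → X) (l : ℕ)

theorem ae_tendsto_average_block_succ_sub_iterate_transfer (g : C(Fin m → X, ℝ)) :
    ∀ᵐ w ∂S.pathMeasure x, Tendsto (fun N : ℕ => (∑ k ∈ Finset.range N,
      (g (S.block x w (l * (k + 1))) - (S.transfer^[l] g) (S.block x w (l * k)))) / N)
      atTop (𝓝 0) := by
  let D (k : ℕ) (w : ℕ → Fin n) : ℝ :=
    g (S.block x w (l * (k + 1))) - (S.transfer^[l] g) (S.block x w (l * k))
  have hmono {i j : ℕ} (hij : i ≤ j) : Set.Iio (l * i) ⊆ Set.Iio (l * j) :=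
    Set.Iio_subset_Iio (Nat.mul_le_mul_left l hij)
  have hD k : DependsOn (D k) (Set.Iio (l * (k + 1))) := fun w w' hw =>
    congrArg₂ (· - ·) (S.dependsOn_comp_block x g _ hw)
      ((S.dependsOn_comp_block x (S.transfer^[l] g) _).mono (hmono k.le_succ) hw)
  have hD_meas k : AEStronglyMeasurable (D k) (S.pathMeasure x) :=
    (measurable_of_dependsOn_finite (Set.finite_Iio _) (hD k)).aestronglyMeasurable
  have hD_bdd k w : |D k w| ≤ ‖g‖ + ‖S.transfer^[l] g‖ :=
    (abs_sub _ _).trans (add_le_add (g.norm_coe_le_norm _)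
      ((S.transfer^[l] g).norm_coe_le_norm _))
  exact ae_tendsto_average_of_orthogonal hD_meas hD_bdd fun i j hij =>
    S.integral_mul_block_sub_iterate_transfer x ((hD i).mono (hmono hij)) l g

theorem ae_tendsto_average_sub_iterate_transfer (g : C(Fin m → X, ℝ)) :
    ∀ᵐ w ∂S.pathMeasure x, Tendsto (fun N : ℕ => (∑ k ∈ Finset.range N,
      (g - S.transfer^[l] g) (S.block x w (l * k))) / N) atTop (𝓝 0) := by
  filter_upwards [S.ae_tendsto_average_block_succ_sub_iterate_transfer x l g] with w hw
  have htelescope := tendsto_average_sub_succ fun k => g.norm_coe_le_norm (S.block x w (l * k))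
  refine (add_zero (0 : ℝ) ▸ htelescope.add hw).congr fun N => ?_
  rw [← add_div, ← Finset.sum_add_distrib]
  simp_rw [sub_add_sub_cancel, ContinuousMap.sub_apply]

theorem ae_forall_tendsto_average_sub_iterate_transfer_mul (g : C(Fin m → X, ℝ)) :
    ∀ᵐ w ∂S.pathMeasure x, ∀ r, Tendsto (fun N : ℕ => (∑ k ∈ Finset.range N,
      (g - S.transfer^[l * r] g) (S.block x w (l * k))) / N) atTop (𝓝 0) := by
  filter_upwards [ae_all_iff.2 fun r =>
    S.ae_tendsto_average_sub_iterate_transfer x l (S.transfer^[l * r] g)] with w hw r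
  induction r with
  | zero => simp
  | succ r ih =>
    refine (add_zero (0 : ℝ) ▸ ih.add (hw r)).congr fun N => ?_
    rw [← add_div, ← Finset.sum_add_distrib, Nat.mul_succ, add_comm (l * r),
      Function.iterate_add_apply]
    simp_rw [ContinuousMap.sub_apply, sub_add_sub_cancel]

variable {l}

theorem ae_tendsto_average_of_tendsto_iterate_transfer (hl : 0 < l) {g : C(Fin m → X, ℝ)} {c : ℝ}
    (hg : Tendsto (fun N => S.transfer^[N] g) atTop (𝓝 (ContinuousMap.const _ c))) :
    ∀ᵐ w ∂S.pathMeasure x, Tendsto (fun N : ℕ => (∑ k ∈ Finset.range N,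
      g (S.block x w (l * k))) / N) atTop (𝓝 c) := by
  filter_upwards [S.ae_forall_tendsto_average_sub_iterate_transfer_mul x l g] with w hw
  have hlim : Tendsto (fun r => g - S.transfer^[l * r] g) atTop
      (𝓝 (g - ContinuousMap.const _ c)) :=
    (hg.comp (tendsto_id.const_mul_atTop' hl)).const_sub g
  have hcentered : Tendsto (fun N : ℕ => (∑ k ∈ Finset.range N,
      (g - ContinuousMap.const (Fin m → X) c) (S.block x w (l * k))) / N) atTop (𝓝 0) :=
    (isClosed_setOf_tendsto_average (fun k => S.block x w (l * k))
      (continuous_const (y := (0 : ℝ)))).mem_of_tendsto hlim (Eventually.of_forall hw)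
  simpa using tendsto_average_add_const hcentered c

theorem exists_measurableSet_tendsto_average (hl : 0 < l) [MeasurableSpace X] [BorelSpace X]
    {α : Measure (Fin m → X)} [IsFiniteMeasure α]
    (hα : ∀ g : C(Fin m → X, ℝ),
      Tendsto (fun N => S.transfer^[N] g) atTop (𝓝 (ContinuousMap.const _ (∫ y, g y ∂α)))) :
    ∃ Ωx : Set (ℕ → Fin n), MeasurableSet Ωx ∧ S.pathMeasure x Ωx = 1 ∧
      ∀ w ∈ Ωx, ∀ g : C(Fin m → X, ℝ), Tendsto (fun N : ℕ => (∑ k ∈ Finset.range N,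
        g (S.block x w (l * k))) / N) atTop (𝓝 (∫ y, g y ∂α)) := by
  obtain ⟨s, hs, hdense⟩ := TopologicalSpace.exists_countable_dense C(Fin m → X, ℝ)
  obtain ⟨Ωx, hfull, hmeas, hΩx⟩ := ((ae_ball_iff hs).2 fun g _ =>
    S.ae_tendsto_average_of_tendsto_iterate_transfer x hl (hα g)).exists_measurable_mem
  refine ⟨Ωx, hmeas, (mem_ae_iff_prob_eq_one hmeas).1 hfull, fun w hw g => ?_⟩
  exact (isClosed_setOf_tendsto_average (fun k => S.block x w (l * k))
    (continuous_integral_continuousMap α)).closure_subset_iff.2 (hΩx w hw) (hdense g)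

end Chain

end GIFSpdp

theorem sum_mul_sub_sum_mul_le {ι κ : Type*} [Fintype ι] [Nonempty ι] [Fintype κ]
    {v a : ι → ℝ} {w b : κ → ℝ} {W D : ℝ} (hv : ∀ i, 0 ≤ v i) (hw : ∀ k, 0 ≤ w k)
    (hvW : ∑ i, v i = W) (hwW : ∑ k, w k = W) (hab : ∀ i k, a i - b k ≤ D) :
    ∑ i, v i * a i - ∑ k, w k * b k ≤ W * D := by
  obtain ⟨i₀, hi₀⟩ := Finite.exists_max a
  have hva : ∑ i, v i * a i ≤ W * a i₀ := by
    rw [← hvW, Finset.sum_mul]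
    exact Finset.sum_le_sum fun i _ => mul_le_mul_of_nonneg_left (hi₀ i) (hv i)
  have hwb : W * (a i₀ - D) ≤ ∑ k, w k * b k := by
    rw [← hwW, Finset.sum_mul]
    exact Finset.sum_le_sum fun k _ =>
      mul_le_mul_of_nonneg_left (sub_le_comm.1 (hab i₀ k)) (hw k)
  linarith

theorem iterate_le_pow_mul {Y : Type*} {f : Y → Y} {ρ : Y → Y → ℝ} {κ : ℝ} (hκ : 0 ≤ κ)
    (hf : ∀ x y, ρ (f x) (f y) ≤ κ * ρ x y) (N : ℕ) (x y : Y) :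
    ρ (f^[N] x) (f^[N] y) ≤ κ ^ N * ρ x y := by
  induction N with
  | zero => simp
  | succ N ih =>
    rw [Function.iterate_succ_apply', Function.iterate_succ_apply', pow_succ', mul_assoc]
    exact (hf _ _).trans (mul_le_mul_of_nonneg_left ih hκ)

theorem exists_forall_iterate_le {Y : Type*} {f : Y → Y} {ρ : Y → Y → ℝ} {κ R ε : ℝ}
    (hκ0 : 0 ≤ κ) (hκ1 : κ < 1) (hf : ∀ x y, ρ (f x) (f y) ≤ κ * ρ x y) (hR : ∀ x y, ρ x y ≤ R)
    (hε : 0 < ε) : ∃ M, ∀ x y, ρ (f^[M] x) (f^[M] y) ≤ ε := by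
  have hlim : Tendsto (fun M : ℕ => κ ^ M * R) atTop (𝓝 0) := by
    simpa using (tendsto_pow_atTop_nhds_zero_of_lt_one hκ0 hκ1).mul_const R
  obtain ⟨M, hM⟩ := (hlim.eventually_le_const hε).exists
  exact ⟨M, fun x y => (iterate_le_pow_mul hκ0 hf M x y).trans
    ((mul_le_mul_of_nonneg_left (hR x y) (pow_nonneg hκ0 M)).trans hM)⟩

theorem tendsto_zero_of_antitone_of_le_convexCombination {D : ℕ → ℝ} (hD : Antitone D)
    (hD0 : ∀ N, 0 ≤ D N)
    (h : ∀ ε > 0, ∃ q > 0, ∃ M, ∀ N, D (N + M) ≤ q * ε + (1 - q) * D N) :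
    Tendsto D atTop (𝓝 0) := by
  have hlim := tendsto_atTop_ciInf hD ⟨0, Set.forall_mem_range.2 hD0⟩
  have hinf : ⨅ N, D N ≤ 0 := by
    refine le_of_forall_pos_le_add fun ε hε => ?_
    obtain ⟨q, hq, M, hM⟩ := h ε hε
    have hle := le_of_tendsto_of_tendsto' (hlim.comp (tendsto_add_atTop_nat M))
      ((hlim.const_mul (1 - q)).const_add (q * ε)) hM
    have hqε : q * ⨅ N, D N ≤ q * ε := by linarith
    simpa using le_of_mul_le_mul_left hqε hq
  rwa [le_antisymm hinf (le_ciInf hD0)] at hlim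

theorem exists_dist_le_add_mul_dist_of_uniformContinuous {Y Z : Type*} [PseudoMetricSpace Y]
    [PseudoMetricSpace Z] {f : Y → Z} (hf : UniformContinuous f)
    (hb : Bornology.IsBounded (Set.range f)) {η : ℝ} (hη : 0 < η) :
    ∃ K, 0 ≤ K ∧ ∀ x y, dist (f x) (f y) ≤ η + K * dist x y := by
  obtain ⟨τ, hτ, hτη⟩ := Metric.uniformContinuous_iff.1 hf η hη
  have hK : 0 ≤ Metric.diam (Set.range f) / τ := div_nonneg Metric.diam_nonneg hτ.le
  refine ⟨Metric.diam (Set.range f) / τ, hK, fun x y => ?_⟩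
  rcases lt_or_ge (dist x y) τ with hxy | hxy
  · exact (hτη hxy).le.trans (le_add_of_nonneg_right (mul_nonneg hK dist_nonneg))
  · calc dist (f x) (f y) ≤ Metric.diam (Set.range f) :=
          Metric.dist_le_diam_of_mem hb ⟨x, rfl⟩ ⟨y, rfl⟩
      _ = Metric.diam (Set.range f) / τ * τ := (div_mul_cancel₀ _ hτ.ne').symm
      _ ≤ Metric.diam (Set.range f) / τ * dist x y := mul_le_mul_of_nonneg_left hxy hK
      _ ≤ η + Metric.diam (Set.range f) / τ * dist x y := le_add_of_nonneg_left hη.le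

theorem dist_le_diam_range {Y Z : Type*} [TopologicalSpace Y] [CompactSpace Y]
    [PseudoMetricSpace Z] (g : C(Y, Z)) (x y : Y) :
    dist (g x) (g y) ≤ Metric.diam (Set.range g) :=
  Metric.dist_le_diam_of_mem (isCompact_range g.continuous).isBounded ⟨x, rfl⟩ ⟨y, rfl⟩

theorem diam_range_le {Y Z : Type*} [PseudoMetricSpace Z] {g : Y → Z} {D : ℝ} (hD : 0 ≤ D)
    (hg : ∀ x y, dist (g x) (g y) ≤ D) : Metric.diam (Set.range g) ≤ D :=
  Metric.diam_le_of_forall_dist_le hD <| Set.forall_mem_range.2 fun x =>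
    Set.forall_mem_range.2 fun y => hg x y

namespace GIFSpdp

theorem nonempty_index {X : Type*} [TopologicalSpace X] {m n : ℕ} (S : GIFSpdp X m n)
    (x : Fin m → X) : Nonempty (Fin n) := by
  by_contra hn
  rw [not_nonempty_iff] at hn
  simpa using S.sum_p x

section WeightedDist

variable {X : Type*} [PseudoMetricSpace X] {m : ℕ}

/-- The maximum distance on `X^m` in which the `i`-th coordinate has the weight `θ ^ i`. For a
suitable `θ > 1` the maps `ext j`, which need not contract the maximum distance because of the
shift, contract this one. -/
noncomputable def weightedDist (θ : ℝ) (x y : Fin m → X) : ℝ :=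
  ‖fun i : Fin m => θ ^ (i : ℕ) * dist (x i) (y i)‖

theorem weightedDist_nonneg (θ : ℝ) (x y : Fin m → X) : 0 ≤ weightedDist θ x y :=
  norm_nonneg _

theorem pow_mul_dist_le_weightedDist (θ : ℝ) (x y : Fin m → X) (i : Fin m) :
    θ ^ (i : ℕ) * dist (x i) (y i) ≤ weightedDist θ x y :=
  (le_abs_self _).trans (norm_le_pi_norm (fun i : Fin m => θ ^ (i : ℕ) * dist (x i) (y i)) i)

theorem weightedDist_le {θ : ℝ} (hθ : 0 ≤ θ) {x y : Fin m → X} {r : ℝ} (hr : 0 ≤ r)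
    (h : ∀ i : Fin m, θ ^ (i : ℕ) * dist (x i) (y i) ≤ r) : weightedDist θ x y ≤ r := by
  refine (pi_norm_le_iff_of_nonneg hr).2 fun i => ?_
  rw [Real.norm_of_nonneg (by positivity)]
  exact h i

theorem dist_le_weightedDist {θ : ℝ} (hθ : 1 ≤ θ) (x y : Fin m → X) :
    dist x y ≤ weightedDist θ x y :=
  (dist_pi_le_iff (weightedDist_nonneg θ x y)).2 fun i =>
    (le_mul_of_one_le_left dist_nonneg (one_le_pow₀ hθ)).trans
      (pow_mul_dist_le_weightedDist θ x y i)

theorem weightedDist_le_pow_mul_dist {θ : ℝ} (hθ : 1 ≤ θ) (x y : Fin m → X) :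
    weightedDist θ x y ≤ θ ^ m * dist x y := by
  have hθ0 := zero_le_one.trans hθ
  refine weightedDist_le hθ0 (by positivity) fun i => ?_
  gcongr
  exacts [i.2.le, dist_le_pi_dist x y i]

end WeightedDist

section Contraction

variable {X : Type*} [PseudoMetricSpace X] {m n : ℕ} (S : GIFSpdp X m n)

theorem weightedDist_ext_le {θ K : ℝ} (hθ : 1 ≤ θ) (hθK : θ ^ m * K ≤ 1) {j : Fin n}
    {x y : Fin m → X} (hφ : dist (S.φ j x) (S.φ j y) ≤ K * weightedDist θ x y) :
    weightedDist θ (S.ext j x) (S.ext j y) ≤ θ⁻¹ * weightedDist θ x y := by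
  have hθ0 : 0 < θ := zero_lt_one.trans_le hθ
  have hρ := weightedDist_nonneg θ x y
  refine weightedDist_le hθ0.le (by positivity) fun i => ?_
  rw [le_inv_mul_iff₀ hθ0, ← mul_assoc, ← pow_succ']
  unfold ext
  split_ifs with h
  · exact pow_mul_dist_le_weightedDist θ x y ⟨i + 1, h⟩
  · have hi : (i : ℕ) + 1 = m := by omega
    calc θ ^ ((i : ℕ) + 1) * dist (S.φ j x) (S.φ j y)
        ≤ θ ^ m * (K * weightedDist θ x y) := by rw [hi]; gcongr
      _ = θ ^ m * K * weightedDist θ x y := (mul_assoc _ _ _).symm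
      _ ≤ weightedDist θ x y := mul_le_of_le_one_left hρ hθK

theorem exists_weightedDist_ext_le (hφ : ∀ j, ∃ K < 1, LipschitzWith K (S.φ j)) :
    ∃ θ : ℝ, 1 < θ ∧ ∀ j x y,
      weightedDist θ (S.ext j x) (S.ext j y) ≤ θ⁻¹ * weightedDist θ x y := by
  choose K hK1 hK using hφ
  have hsmall j : ∀ᶠ θ : ℝ in 𝓝[>] 1, θ ^ m * K j < 1 := by
    have hcont : Tendsto (fun θ : ℝ => θ ^ m * K j) (𝓝[>] 1) (𝓝 (1 ^ m * K j)) :=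
      (Continuous.tendsto (by fun_prop) 1).mono_left nhdsWithin_le_nhds
    exact hcont.eventually_lt_const (by simpa using hK1 j)
  obtain ⟨θ, hθK, hθ⟩ :=
    ((eventually_all.2 hsmall).and (eventually_mem_nhdsWithin (a := (1 : ℝ)))).exists
  have hθ : 1 < θ := hθ
  exact ⟨θ, hθ, fun j x y => S.weightedDist_ext_le hθ.le (hθK j).le <|
    ((hK j).dist_le_mul x y).trans
      (mul_le_mul_of_nonneg_left (dist_le_weightedDist hθ.le x y) (K j).2)⟩

theorem exists_sum_abs_p_sub_le (hp : ∀ j, ∃ C, LipschitzWith C (S.p j)) :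
    ∃ C, 0 ≤ C ∧ ∀ x y, ∑ j, |S.p j x - S.p j y| ≤ C * dist x y := by
  choose C hC using hp
  refine ⟨∑ j, (C j : ℝ), by positivity, fun x y => ?_⟩
  rw [Finset.sum_mul]
  exact Finset.sum_le_sum fun j _ => (hC j).dist_le_mul x y

end Contraction

section Transfer

variable {X : Type*} [MetricSpace X] {m n : ℕ} (S : GIFSpdp X m n)

theorem dist_transfer_le_add_mul {ρ : (Fin m → X) → (Fin m → X) → ℝ} {κ C η K B : ℝ}
    (hρ : ∀ j x y, ρ (S.ext j x) (S.ext j y) ≤ κ * ρ x y)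
    (hp : ∀ x y, ∑ j, |S.p j x - S.p j y| ≤ C * ρ x y) (hK : 0 ≤ K) (hB : 0 ≤ B)
    {g : C(Fin m → X, ℝ)} (hgB : ∀ x, |g x| ≤ B)
    (hg : ∀ x y, dist (g x) (g y) ≤ η + K * ρ x y) (x y : Fin m → X) :
    dist (S.transfer g x) (S.transfer g y) ≤ η + (κ * K + C * B) * ρ x y := by
  have hsplit : S.transfer g x - S.transfer g y =
      ∑ j, S.p j x * (g (S.ext j x) - g (S.ext j y)) +
        ∑ j, (S.p j x - S.p j y) * g (S.ext j y) := by
    simp_rw [mul_sub, sub_mul, Finset.sum_sub_distrib, sub_add_sub_cancel]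
    rfl
  have hmaps : |∑ j, S.p j x * (g (S.ext j x) - g (S.ext j y))| ≤ η + K * (κ * ρ x y) := by
    calc |∑ j, S.p j x * (g (S.ext j x) - g (S.ext j y))|
        ≤ ∑ j, S.p j x * (η + K * (κ * ρ x y)) := by
          refine (Finset.abs_sum_le_sum_abs _ _).trans (Finset.sum_le_sum fun j _ => ?_)
          rw [abs_mul, abs_of_nonneg (S.p_mem j x).1]
          exact mul_le_mul_of_nonneg_left ((hg _ _).trans (add_le_add_right
            (mul_le_mul_of_nonneg_left (hρ j x y) hK) η)) (S.p_mem j x).1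
      _ = η + K * (κ * ρ x y) := by rw [← Finset.sum_mul, S.sum_p, one_mul]
  have hweights : |∑ j, (S.p j x - S.p j y) * g (S.ext j y)| ≤ C * ρ x y * B := by
    calc |∑ j, (S.p j x - S.p j y) * g (S.ext j y)|
        ≤ ∑ j, |S.p j x - S.p j y| * B := by
          refine (Finset.abs_sum_le_sum_abs _ _).trans (Finset.sum_le_sum fun j _ => ?_)
          rw [abs_mul]
          exact mul_le_mul_of_nonneg_left (hgB _) (abs_nonneg _)
      _ ≤ C * ρ x y * B := by
          rw [← Finset.sum_mul]
          exact mul_le_mul_of_nonneg_right (hp x y) hB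
  rw [Real.dist_eq, hsplit]
  linarith [abs_add_le (∑ j, S.p j x * (g (S.ext j x) - g (S.ext j y)))
    (∑ j, (S.p j x - S.p j y) * g (S.ext j y))]

variable [CompactSpace X]

/-- The mass `δ` that `x` and `y` both give to the map `ext j₀` is moved by it; the remaining mass
`1 - δ` contributes at most the oscillation of `g`. -/
theorem transfer_sub_transfer_le {δ : ℝ} {j₀ : Fin n} (hδ : ∀ x, δ ≤ S.p j₀ x)
    (g : C(Fin m → X, ℝ)) (x y : Fin m → X) :
    S.transfer g x - S.transfer g y ≤
      δ * (g (S.ext j₀ x) - g (S.ext j₀ y)) + (1 - δ) * Metric.diam (Set.range g) := by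
  let q (z : Fin m → X) (j : Fin n) : ℝ := S.p j z - if j = j₀ then δ else 0
  have hq z j : 0 ≤ q z j := by
    dsimp only [q]
    split_ifs with hj
    · exact sub_nonneg.2 (hj ▸ hδ z)
    · simpa using (S.p_mem j z).1
  have hq_sum z : ∑ j, q z j = 1 - δ := by
    simp [q, Finset.sum_sub_distrib, S.sum_p]
  have hsplit z : S.transfer g z = δ * g (S.ext j₀ z) + ∑ j, q z j * g (S.ext j z) := by
    simp_rw [q, sub_mul, Finset.sum_sub_distrib, ite_mul, zero_mul, Finset.sum_ite_eq',
      Finset.mem_univ, if_true, add_sub_cancel]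
    rfl
  have : Nonempty (Fin n) := ⟨j₀⟩
  have hrest := sum_mul_sub_sum_mul_le (hq x) (hq y) (hq_sum x) (hq_sum y) fun i k =>
    (le_abs_self _).trans (dist_le_diam_range g (S.ext i x) (S.ext k y))
  rw [hsplit x, hsplit y]
  linarith

theorem dist_transfer_le {δ : ℝ} (hδ0 : 0 ≤ δ) {j₀ : Fin n} (hδ : ∀ x, δ ≤ S.p j₀ x)
    (g : C(Fin m → X, ℝ)) (x y : Fin m → X) :
    dist (S.transfer g x) (S.transfer g y) ≤
      δ * dist (g (S.ext j₀ x)) (g (S.ext j₀ y)) + (1 - δ) * Metric.diam (Set.range g) := by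
  have hle x y := (S.transfer_sub_transfer_le hδ g x y).trans
    (add_le_add_left (mul_le_mul_of_nonneg_left
      (le_abs_self (g (S.ext j₀ x) - g (S.ext j₀ y))) hδ0) _)
  exact abs_sub_le_iff.2 ⟨hle x y, by simpa only [abs_sub_comm, Real.dist_eq] using hle y x⟩

theorem diam_range_transfer_le (g : C(Fin m → X, ℝ)) :
    Metric.diam (Set.range (S.transfer g)) ≤ Metric.diam (Set.range g) := by
  refine diam_range_le Metric.diam_nonneg fun x y => ?_
  obtain ⟨j⟩ := S.nonempty_index x
  simpa using S.dist_transfer_le le_rfl (fun z => (S.p_mem j z).1) g x y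

theorem antitone_diam_range_iterate_transfer (g : C(Fin m → X, ℝ)) :
    Antitone fun N => Metric.diam (Set.range (S.transfer^[N] g)) :=
  antitone_nat_of_succ_le fun N => by
    rw [Function.iterate_succ_apply']
    exact S.diam_range_transfer_le _

theorem dist_iterate_transfer_le {δ : ℝ} (hδ0 : 0 ≤ δ) (hδ1 : δ ≤ 1) {j₀ : Fin n}
    (hδ : ∀ x, δ ≤ S.p j₀ x) (g : C(Fin m → X, ℝ)) (M : ℕ) (x y : Fin m → X) :
    dist ((S.transfer^[M] g) x) ((S.transfer^[M] g) y) ≤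
      δ ^ M * dist (g ((S.ext j₀)^[M] x)) (g ((S.ext j₀)^[M] y)) +
        (1 - δ ^ M) * Metric.diam (Set.range g) := by
  induction M generalizing x y with
  | zero => simp
  | succ M ih =>
    rw [Function.iterate_succ_apply', Function.iterate_succ_apply, Function.iterate_succ_apply]
    have hstep := S.dist_transfer_le hδ0 hδ (S.transfer^[M] g) x y
    have hosc := mul_le_mul_of_nonneg_left
      (S.antitone_diam_range_iterate_transfer g (Nat.zero_le M)) (sub_nonneg.2 hδ1)
    have hrec := mul_le_mul_of_nonneg_left (ih (S.ext j₀ x) (S.ext j₀ y)) hδ0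
    rw [pow_succ']
    simp only [Function.iterate_zero, id_eq] at hosc
    linarith

theorem norm_transfer_le (g : C(Fin m → X, ℝ)) : ‖S.transfer g‖ ≤ ‖g‖ := by
  refine (ContinuousMap.norm_le _ (norm_nonneg _)).2 fun x => ?_
  calc ‖∑ j, S.p j x * g (S.ext j x)‖ ≤ ∑ j, S.p j x * ‖g‖ := by
        refine norm_sum_le_of_le _ fun j _ => ?_
        rw [norm_mul, Real.norm_of_nonneg (S.p_mem j x).1]
        exact mul_le_mul_of_nonneg_left (g.norm_coe_le_norm _) (S.p_mem j x).1
    _ = ‖g‖ := by rw [← Finset.sum_mul, S.sum_p, one_mul]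

theorem abs_iterate_transfer_apply_le (g : C(Fin m → X, ℝ)) (N : ℕ) (x : Fin m → X) :
    |(S.transfer^[N] g) x| ≤ ‖g‖ := by
  refine ((S.transfer^[N] g).norm_coe_le_norm x).trans ?_
  induction N with
  | zero => rfl
  | succ N ih =>
    rw [Function.iterate_succ_apply']
    exact (S.norm_transfer_le _).trans ih

theorem exists_forall_dist_iterate_transfer_le {ρ : (Fin m → X) → (Fin m → X) → ℝ}
    {κ C η K₀ : ℝ} (hκ : κ < 1) (hρ0 : ∀ x y, 0 ≤ ρ x y)
    (hρ : ∀ j x y, ρ (S.ext j x) (S.ext j y) ≤ κ * ρ x y)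
    (hp : ∀ x y, ∑ j, |S.p j x - S.p j y| ≤ C * ρ x y) (hK₀ : 0 ≤ K₀)
    {g : C(Fin m → X, ℝ)} (hg : ∀ x y, dist (g x) (g y) ≤ η + K₀ * ρ x y) :
    ∃ K, 0 ≤ K ∧ ∀ N x y,
      dist ((S.transfer^[N] g) x) ((S.transfer^[N] g) y) ≤ η + K * ρ x y := by
  -- `K ≥ K₀` is large enough to be preserved by the recursion `K ↦ κ * K + C * ‖g‖`.
  let K := max K₀ (C * ‖g‖ / (1 - κ))
  have hK : 0 ≤ K := hK₀.trans (le_max_left _ _)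
  have hrec : κ * K + C * ‖g‖ ≤ K := by
    linarith [(div_le_iff₀ (sub_pos.2 hκ)).1 (le_max_right K₀ (C * ‖g‖ / (1 - κ)))]
  refine ⟨K, hK, fun N => ?_⟩
  induction N with
  | zero =>
    exact fun x y => (hg x y).trans
      (add_le_add_right (mul_le_mul_of_nonneg_right (le_max_left _ _) (hρ0 x y)) η)
  | succ N ih =>
    intro x y
    rw [Function.iterate_succ_apply']
    exact (S.dist_transfer_le_add_mul hρ hp hK (norm_nonneg g)
      (S.abs_iterate_transfer_apply_le g N) ih x y).trans
        (add_le_add_right (mul_le_mul_of_nonneg_right hrec (hρ0 x y)) η)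

theorem exists_forall_pos_le_p (hpos : ∃ j, ∀ x, 0 < S.p j x) :
    ∃ j, ∃ δ > 0, δ ≤ 1 ∧ ∀ x, δ ≤ S.p j x := by
  obtain ⟨j, hj⟩ := hpos
  obtain ⟨δ, hδ0, hδ⟩ := isCompact_univ.exists_forall_le' (S.continuous_p j).continuousOn
    fun x _ => hj x
  exact ⟨j, min δ 1, lt_min hδ0 one_pos, min_le_right _ _,
    fun x => (min_le_left _ _).trans (hδ x trivial)⟩

theorem exists_forall_dist_iterate_transfer_le_add_mul_weightedDist {θ η : ℝ} (hθ : 1 < θ)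
    (hext : ∀ j x y, weightedDist θ (S.ext j x) (S.ext j y) ≤ θ⁻¹ * weightedDist θ x y)
    (hp : ∀ j, ∃ C, LipschitzWith C (S.p j)) (hη : 0 < η) (g : C(Fin m → X, ℝ)) :
    ∃ K, 0 ≤ K ∧ ∀ N x y,
      dist ((S.transfer^[N] g) x) ((S.transfer^[N] g) y) ≤ η + K * weightedDist θ x y := by
  obtain ⟨C, hC0, hC⟩ := S.exists_sum_abs_p_sub_le hp
  obtain ⟨K₀, hK₀, hg⟩ := exists_dist_le_add_mul_dist_of_uniformContinuous
    (CompactSpace.uniformContinuous_of_continuous g.continuous)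
    (isCompact_range g.continuous).isBounded hη
  have hdist := dist_le_weightedDist hθ.le (X := X) (m := m)
  exact S.exists_forall_dist_iterate_transfer_le (inv_lt_one_of_one_lt₀ hθ)
    (weightedDist_nonneg θ) hext
    (fun x y => (hC x y).trans (mul_le_mul_of_nonneg_left (hdist x y) hC0)) hK₀
    fun x y => (hg x y).trans (add_le_add_right (mul_le_mul_of_nonneg_left (hdist x y) hK₀) η)

theorem diam_range_iterate_transfer_add_le {δ : ℝ} (hδ0 : 0 ≤ δ) (hδ1 : δ ≤ 1) {j₀ : Fin n}
    (hδ : ∀ x, δ ≤ S.p j₀ x) {g : C(Fin m → X, ℝ)} {N M : ℕ} {ε : ℝ} (hε : 0 ≤ ε)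
    (hg : ∀ x y, dist ((S.transfer^[N] g) ((S.ext j₀)^[M] x))
      ((S.transfer^[N] g) ((S.ext j₀)^[M] y)) ≤ ε) :
    Metric.diam (Set.range (S.transfer^[N + M] g)) ≤
      δ ^ M * ε + (1 - δ ^ M) * Metric.diam (Set.range (S.transfer^[N] g)) := by
  have hδM : 0 ≤ 1 - δ ^ M := sub_nonneg.2 (pow_le_one₀ hδ0 hδ1)
  rw [add_comm, Function.iterate_add_apply]
  refine diam_range_le
    (add_nonneg (by positivity) (mul_nonneg hδM Metric.diam_nonneg)) fun x y => ?_
  refine (S.dist_iterate_transfer_le hδ0 hδ1 hδ (S.transfer^[N] g) M x y).trans ?_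
  gcongr
  exact hg x y

theorem tendsto_diam_range_iterate_transfer (hφ : ∀ j, ∃ K < 1, LipschitzWith K (S.φ j))
    (hp : ∀ j, ∃ C, LipschitzWith C (S.p j)) (hpos : ∃ j, ∀ x, 0 < S.p j x)
    (g : C(Fin m → X, ℝ)) :
    Tendsto (fun N => Metric.diam (Set.range (S.transfer^[N] g))) atTop (𝓝 0) := by
  obtain ⟨θ, hθ, hext⟩ := S.exists_weightedDist_ext_le hφ
  obtain ⟨j₀, δ, hδ0, hδ1, hδ⟩ := S.exists_forall_pos_le_p hpos
  refine tendsto_zero_of_antitone_of_le_convexCombination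
    (S.antitone_diam_range_iterate_transfer g) (fun N => Metric.diam_nonneg) fun ε hε => ?_
  obtain ⟨K, hK0, hK⟩ := S.exists_forall_dist_iterate_transfer_le_add_mul_weightedDist hθ hext hp
    (half_pos hε) g
  obtain ⟨M, hM⟩ := exists_forall_iterate_le (R := θ ^ m * Metric.diam (Set.univ (α := Fin m → X)))
    (ε := ε / 2 / (K + 1)) (inv_nonneg.2 (zero_le_one.trans hθ.le)) (inv_lt_one_of_one_lt₀ hθ)
    (hext j₀) (fun x y => (weightedDist_le_pow_mul_dist hθ.le x y).trans (by
      gcongr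
      exact Metric.dist_le_diam_of_mem isCompact_univ.isBounded trivial trivial)) (by positivity)
  refine ⟨δ ^ M, pow_pos hδ0 M, M, fun N =>
    S.diam_range_iterate_transfer_add_le hδ0.le hδ1 hδ hε.le fun x y => ?_⟩
  have hKM : (K + 1) * weightedDist θ ((S.ext j₀)^[M] x) ((S.ext j₀)^[M] y) ≤ ε / 2 :=
    (le_div_iff₀' (by positivity)).1 (hM x y)
  linarith [hK N ((S.ext j₀)^[M] x) ((S.ext j₀)^[M] y),
    weightedDist_nonneg θ ((S.ext j₀)^[M] x) ((S.ext j₀)^[M] y)]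

end Transfer

end GIFSpdp

theorem dist_apply_integral_le_diam_range {Y : Type*} [TopologicalSpace Y] [CompactSpace Y]
    [MeasurableSpace Y] [BorelSpace Y] (g : C(Y, ℝ)) (μ : Measure Y) [IsProbabilityMeasure μ]
    (y : Y) : dist (g y) (∫ z, g z ∂μ) ≤ Metric.diam (Set.range g) := by
  rw [dist_comm]
  exact (convex_closedBall (g y) _).integral_mem Metric.isClosed_closedBall
    (ae_of_all _ fun z => dist_le_diam_range g z y)
    (g.continuous.integrable_of_hasCompactSupport (HasCompactSupport.of_compactSpace g))

theorem dist_integral_integral_le_diam_range {Y : Type*} [TopologicalSpace Y] [CompactSpace Y]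
    [MeasurableSpace Y] [BorelSpace Y] (g : C(Y, ℝ)) (μ ν : Measure Y) [IsProbabilityMeasure μ]
    [IsProbabilityMeasure ν] :
    dist (∫ z, g z ∂μ) (∫ z, g z ∂ν) ≤ Metric.diam (Set.range g) :=
  (convex_closedBall (∫ z, g z ∂ν) _).integral_mem Metric.isClosed_closedBall
    (ae_of_all _ (dist_apply_integral_le_diam_range g ν))
    (g.continuous.integrable_of_hasCompactSupport (HasCompactSupport.of_compactSpace g))

theorem probabilityMeasure_eq_of_forall_integral_continuousMap_eq {Y : Type*}
    [TopologicalSpace Y] [HasOuterApproxClosed Y] [MeasurableSpace Y] [BorelSpace Y]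
    {α β : ProbabilityMeasure Y}
    (h : ∀ g : C(Y, ℝ), ∫ y, g y ∂(α : Measure Y) = ∫ y, g y ∂(β : Measure Y)) : α = β :=
  ProbabilityMeasure.toMeasure_injective <|
    ext_of_forall_integral_eq_of_IsFiniteMeasure fun f => h f.toContinuousMap

theorem LipCoeff.lipschitzWith {X Y : Type*} [PseudoMetricSpace X] [PseudoMetricSpace Y]
    {m : ℕ} {a : Fin m → ℝ} {f : (Fin m → X) → Y} (h : LipCoeff a f) :
    LipschitzWith (∑ i, a i).toNNReal f := by
  refine LipschitzWith.of_dist_le' fun x y => (h.2 x y).trans ?_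
  rw [Finset.sum_mul]
  exact Finset.sum_le_sum fun i _ =>
    mul_le_mul_of_nonneg_left (dist_le_pi_dist x y i) (h.1 i).le

namespace GIFSpdp

section Hutchinson

variable {X : Type*} [MetricSpace X] [CompactSpace X] [MeasurableSpace X] [BorelSpace X]
  {m n : ℕ} (S : GIFSpdp X m n)

theorem integral_iterate_markov (α : ProbabilityMeasure (Fin m → X)) (N : ℕ)
    (g : C(Fin m → X, ℝ)) :
    ∫ x, g x ∂(S.markov^[N] α : Measure (Fin m → X)) =
      ∫ x, (S.transfer^[N] g) x ∂(α : Measure (Fin m → X)) := by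
  induction N generalizing g with
  | zero => rfl
  | succ N ih =>
    rw [Function.iterate_succ_apply', integral_markov, ih, Function.iterate_succ_apply]

variable {S}

theorem exists_markov_eq_self [Nonempty X]
    (hosc : ∀ g : C(Fin m → X, ℝ),
      Tendsto (fun N => Metric.diam (Set.range (S.transfer^[N] g))) atTop (𝓝 0)) :
    ∃ α, S.markov α = α := by
  let ν : ProbabilityMeasure (Fin m → X) := diracProba (Classical.arbitrary (Fin m → X))
  obtain ⟨α, u, hu, hα⟩ := CompactSpace.tendsto_subseq fun N => S.markov^[N] ν
  have hlim (g : C(Fin m → X, ℝ)) :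
      Tendsto (fun k => ∫ x, (S.transfer^[u k] g) x ∂(ν : Measure (Fin m → X))) atTop
        (𝓝 (∫ x, g x ∂(α : Measure (Fin m → X)))) := by
    simp_rw [← S.integral_iterate_markov ν]
    exact ProbabilityMeasure.tendsto_iff_forall_integral_tendsto.1 hα
      (BoundedContinuousFunction.mkOfCompact g)
  refine ⟨α, probabilityMeasure_eq_of_forall_integral_continuousMap_eq fun g => ?_⟩
  have hdiff : Tendsto (fun k =>
      ∫ x, (S.transfer^[u k] (S.transfer g)) x ∂(ν : Measure (Fin m → X)) -
        ∫ x, (S.transfer^[u k] g) x ∂(ν : Measure (Fin m → X))) atTop (𝓝 0) := by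
    refine squeeze_zero_norm (fun k => ?_) ((hosc g).comp hu.tendsto_atTop)
    rw [← Function.iterate_succ_apply, Function.iterate_succ_apply', ← S.integral_markov]
    exact dist_integral_integral_le_diam_range _ _ _
  rw [S.integral_markov]
  exact sub_eq_zero.1 (tendsto_nhds_unique ((hlim (S.transfer g)).sub (hlim g)) hdiff)

theorem tendsto_iterate_transfer_of_markov_eq_self {α : ProbabilityMeasure (Fin m → X)}
    (hα : S.markov α = α) {g : C(Fin m → X, ℝ)}
    (hosc : Tendsto (fun N => Metric.diam (Set.range (S.transfer^[N] g))) atTop (𝓝 0)) :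
    Tendsto (fun N => S.transfer^[N] g) atTop
      (𝓝 (ContinuousMap.const _ (∫ y, g y ∂(α : Measure (Fin m → X))))) := by
  refine tendsto_iff_dist_tendsto_zero.2 (squeeze_zero (fun N => dist_nonneg) (fun N => ?_) hosc)
  refine (ContinuousMap.dist_le Metric.diam_nonneg).2 fun x => ?_
  have hinv : ∫ y, g y ∂(α : Measure (Fin m → X)) =
      ∫ y, (S.transfer^[N] g) y ∂(α : Measure (Fin m → X)) := by
    rw [← S.integral_iterate_markov, Function.iterate_fixed hα]
  rw [ContinuousMap.const_apply, hinv]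
  exact dist_apply_integral_le_diam_range (S.transfer^[N] g) _ x

theorem isExtendedHutchinson_of_markov_eq_self {α : ProbabilityMeasure (Fin m → X)}
    (hα : S.markov α = α)
    (hosc : ∀ g : C(Fin m → X, ℝ),
      Tendsto (fun N => Metric.diam (Set.range (S.transfer^[N] g))) atTop (𝓝 0)) :
    S.IsExtendedHutchinson α := by
  obtain ⟨x⟩ := nonempty_of_isProbabilityMeasure (α : Measure (Fin m → X))
  refine ⟨hα, fun β hβ => probabilityMeasure_eq_of_forall_integral_continuousMap_eq fun g => ?_⟩
  have hconst := tendsto_nhds_unique (tendsto_iterate_transfer_of_markov_eq_self hβ (hosc g))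
    (tendsto_iterate_transfer_of_markov_eq_self hα (hosc g))
  exact DFunLike.congr_fun hconst x

end Hutchinson

section Hypotheses

variable {X : Type*} [MetricSpace X] {m n : ℕ} {S : GIFSpdp X m n}

theorem E1.exists_lipschitzWith (h : S.E1) (j : Fin n) : ∃ K < 1, LipschitzWith K (S.φ j) := by
  obtain ⟨a, ha, ha1⟩ := h j
  exact ⟨_, Real.toNNReal_lt_one.2 ha1, ha.lipschitzWith⟩

theorem E2.exists_lipschitzWith (h : S.E2) (j : Fin n) : ∃ C, LipschitzWith C (S.p j) := by
  obtain ⟨c, hc, -⟩ := h.2 j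
  exact ⟨_, hc.lipschitzWith⟩

theorem E2.exists_forall_p_pos [Nonempty X] (h : S.E2) : ∃ j, ∀ x, 0 < S.p j x := by
  obtain ⟨j⟩ := S.nonempty_index (Classical.arbitrary (Fin m → X))
  obtain ⟨δ, hδ0, hδ⟩ := h.1
  exact ⟨j, fun x => hδ0.trans_le (hδ j x)⟩

end Hypotheses

end GIFSpdp

theorem mainTheorem2_general {X : Type*} [MetricSpace X] [CompactSpace X] [Nonempty X]
    [MeasurableSpace X] [BorelSpace X] {m n l : ℕ} (hl : 0 < l) (S : GIFSpdp X m n)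
    (hφ : ∀ j, ∃ K < 1, LipschitzWith K (S.φ j)) (hp : ∀ j, ∃ C, LipschitzWith C (S.p j))
    (hpos : ∃ j, ∀ x, 0 < S.p j x) :
    ∃ α : ProbabilityMeasure (Fin m → X), S.IsExtendedHutchinson α ∧
      ∀ x : Fin m → X, ∃ Ωx : Set (ℕ → Fin n),
        MeasurableSet Ωx ∧ S.pathMeasure x Ωx = 1 ∧
        ∀ w ∈ Ωx, ∀ g : C(Fin m → X, ℝ),
          Tendsto
            (fun N : ℕ => (1 / (N : ℝ)) * ∑ k ∈ Finset.range N, g (S.block x w (l * k)))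
            atTop (𝓝 (∫ y, g y ∂(α : Measure (Fin m → X)))) := by
  have hosc := S.tendsto_diam_range_iterate_transfer hφ hp hpos
  obtain ⟨α, hα⟩ := GIFSpdp.exists_markov_eq_self hosc
  refine ⟨α, GIFSpdp.isExtendedHutchinson_of_markov_eq_self hα hosc, fun x => ?_⟩
  simp_rw [one_div_mul_eq_div]
  exact S.exists_measurableSet_tendsto_average x hl fun g =>
    GIFSpdp.tendsto_iterate_transfer_of_markov_eq_self hα (hosc g)

theorem mainTheorem2 {X : Type*} [MetricSpace X] [CompactSpace X] [Nonempty X]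
    [MeasurableSpace X] [BorelSpace X] {m n : ℕ} (hm : 1 ≤ m)
    (S : GIFSpdp X m n) (hE1 : S.E1) (hE2 : S.E2) :
    ∃ α : ProbabilityMeasure (Fin m → X), S.IsExtendedHutchinson α ∧
      ∀ x : Fin m → X, ∃ Ωx : Set (ℕ → Fin n),
        MeasurableSet Ωx ∧ S.pathMeasure x Ωx = 1 ∧
        ∀ w ∈ Ωx, ∀ g : C(Fin m → X, ℝ),
          Tendsto
            (fun N : ℕ => (1 / (N : ℝ)) *
              ∑ k ∈ Finset.range N, g (fun i : Fin m => S.orbit x w (m * k + i)))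
            atTop (𝓝 (∫ y, g y ∂(α : Measure (Fin m → X)))) := by
  exact mainTheorem2_general hm S hE1.exists_lipschitzWith hE2.exists_lipschitzWith
    hE2.exists_forall_p_pos
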